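/- Let $(S,\Sigma)$ be a measurable space and let $P$ be a transition probability kernel on $S$. For $s\in S$ let $\mathsf P_{\delta_s}$ denote the law, on the space $S^{\omega}$ of infinite trajectories with the product $\sigma$-algebra, of the time-homogeneous Markov chain $(\Phi_n)_{n\ge 0}$ with transition kernel $P$ started at $s$. For $A\in\Sigma$ let $$\mathrm{Fin}(A)=\bigcup_{n}\bigcap_{m\ge n}\{\Phi_m\notin A\},\qquad \mathrm{Inf}(A)=\bigcap_{n}\bigcup_{m\ge n}\{\Phi_m\in A\},\qquad \sigma_A=\inf\{n\ge 1:\Phi_n\in A\}\in\mathbb N\cup\{\infty\},$$ and let $I^\omega=\{\Phi_n\in I\text{ for all }n\ge 0\}$ for $I\in\Sigma$. Let $(A_1,B_1),\dots,(A_k,B_k)\in\Sigma^2$, and let $I\in\Sigma$ be such that $$\forall s\in S:\qquad \mathsf P_{\delta_s}\Bigl((I^\omega)^{\mathsf c}\cup\bigcap_{i=1}^k\bigl(\mathrm{Fin}(A_i)\cup\mathrm{Inf}(B_i)\bigr)\Bigr)=1 .$$ Then there exist regions $J_1,\dots,J_k\in\Sigma$ with $J_i\subseteq I\smallsetminus A_i$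 such that, for every $i=1,\dots,k$, $$\sup_{s\in J_i}\mathsf P_{\delta_s}(\sigma_{A_i}<\infty)<1\qquad\text{and}\qquad \inf_{s\in I}\mathsf P_{\delta_s}\bigl(\sigma_{B_i\cup J_i\cup I^{\mathsf c}}<\infty\bigr)=1 ,$$ where suprema and infima are taken in $[0,1]$ (so that over the empty set they are $0$ and $1$, respectively). More precisely, the regions $$J_i=\{s\in I\smallsetminus A_i:\ \mathsf P_{\delta_s}(\sigma_{A_i}<\infty)\le \tfrac12\}$$ are measurable and have these properties. -/

import Mathlib

open MeasureTheory ProbabilityTheory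

/-- The one-step kernels of a time-homogeneous chain, as kernels on finite histories: given the
history `(x 0, …, x n)`, the next state is distributed according to `P (x n)`. -/
noncomputable def stepKernel {S : Type*} [MeasurableSpace S] (P : Kernel S S) (n : ℕ) :
    Kernel ((_ : Finset.Iic n) → S) S :=
  P.comap (fun x => x ⟨n, Finset.mem_Iic.mpr le_rfl⟩) (measurable_pi_apply _)

instance stepKernel.instIsMarkovKernel {S : Type*} [MeasurableSpace S] (P : Kernel S S)
    [IsMarkovKernel P] (n : ℕ) : IsMarkovKernel (stepKernel P n) := by
  unfold stepKernel
  infer_instance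

/-- The law `P_μ`, on the space `ℕ → S` of infinite trajectories with the product σ-algebra, of the
time-homogeneous Markov chain with initial distribution `μ` and transition kernel `P`
(obtained from the Ionescu-Tulcea theorem). The chain itself is the coordinate process. -/
noncomputable def chainLaw {S : Type*} [MeasurableSpace S] (P : Kernel S S) [IsMarkovKernel P]
    (μ : Measure S) : Measure (ℕ → S) :=
  Kernel.trajMeasure (X := fun _ => S) μ (stepKernel P)

instance chainLaw.instIsProbabilityMeasure {S : Type*} [MeasurableSpace S] (P : Kernel S S)
    [IsMarkovKernel P] (μ : Measure S) [IsProbabilityMeasure μ] :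
    IsProbabilityMeasure (chainLaw P μ) := by
  unfold chainLaw
  infer_instance

/-- `P_{δ_s}(L)`, the probability of the event `L` for the chain started in the state `s`, as an
element of `[0, 1]`. Suprema and infima of probabilities are taken in `[0, 1]`. -/
noncomputable def probFrom {S : Type*} [MeasurableSpace S] (P : Kernel S S) [IsMarkovKernel P]
    (s : S) (L : Set (ℕ → S)) : unitInterval :=
  ⟨(chainLaw P (Measure.dirac s)).real L, measureReal_nonneg, measureReal_le_one⟩

/-- `Fin(A)`: the trajectories that visit `A` finitely often. -/
def finVisits {S : Type*} (A : Set S) : Set (ℕ → S) :=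
  ⋃ n : ℕ, ⋂ m ≥ n, {ω | ω m ∉ A}

/-- `Inf(A)`: the trajectories that visit `A` infinitely often. -/
def infVisits {S : Type*} (A : Set S) : Set (ℕ → S) :=
  ⋂ n : ℕ, ⋃ m ≥ n, {ω | ω m ∈ A}

/-- The reactivity property of the Streett pairs `(A i, B i)`. -/
def reactivity {S : Type*} {k : ℕ} (A B : Fin k → Set S) : Set (ℕ → S) :=
  ⋂ i, (finVisits (A i) ∪ infVisits (B i))

/-- `I^ω`: the trajectories that remain in `I` forever. -/
def stayIn {S : Type*} (I : Set S) : Set (ℕ → S) :=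
  {ω | ∀ n, ω n ∈ I}

/-- The shift operator, which deletes the first element of a trajectory. -/
def shift {S : Type*} (ω : ℕ → S) : ℕ → S :=
  fun n => ω (n + 1)

/-- First hitting time `τ_A = inf {n ≥ 0 : ω n ∈ A}`, with value `⊤` if `A` is never hit. -/
noncomputable def hitTime {S : Type*} (A : Set S) (ω : ℕ → S) : ℕ∞ :=
  hittingAfter (fun n (ω : ℕ → S) => ω n) A 0 ω

/-- First return time `σ_A = 1 + τ_A ∘ θ`, where `θ` is the shift. -/
noncomputable def returnTime {S : Type*} (A : Set S) (ω : ℕ → S) : ℕ∞ :=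
  1 + hitTime A (shift ω)

open Filter Topology
open scoped ENNReal

/-! The bound on the supremum is built into `J i`. For the infimum, consider a trajectory from `I`
that never returns to `B i ∪ J i ∪ Iᶜ`. It stays in `I` and avoids `B i` from time 1 on, so
reactivity makes it leave `A i` for good. From then on it lies in `I \ A i` but outside `J i`, hence
in the set `G` of states outside `A i` whose return probability to `A i` exceeds 1/2.

Being eventually always in `G` is a null event. From a state of `G`, staying in `G` forever excludes
a return to `A i`, so it has probability at most 1/2; by the Markov property such a uniform bound
below 1 forces probability 0 (`chainLaw_dirac_stayIn_eq_zero`). Only the Markov property at time one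
is needed (`map_shift_chainLaw_dirac`); it follows from uniqueness of the chain's law. -/

theorem measurable_shift {S : Type*} [MeasurableSpace S] : Measurable (shift (S := S)) := by
  unfold shift
  fun_prop

/-! ### Uniqueness of the law and the Markov property -/

/-- A measure on trajectories is determined by its finite-dimensional marginals on initial
segments of time. -/
theorem measure_ext_of_map_frestrictLe {S : Type*} [MeasurableSpace S] {m m' : Measure (ℕ → S)}
    [IsProbabilityMeasure m] [IsProbabilityMeasure m']
    (h : ∀ a, m.map (Preorder.frestrictLe (π := fun _ => S) a) = m'.map (Preorder.frestrictLe a)) :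
    m = m' := by
  refine ext_of_generate_finite (measurableCylinders fun _ : ℕ => S)
    generateFrom_measurableCylinders.symm isPiSystem_measurableCylinders ?_ (by simp)
  intro t ht
  obtain ⟨N, T, hT, rfl⟩ : ∃ N T, MeasurableSet T ∧ t = cylinder (Finset.Iic N) T := by
    simpa [measurableCylinders_nat] using ht
  have := congrArg (fun μ => μ T) (h N)
  simp only [Measure.map_apply (Preorder.measurable_frestrictLe (X := fun _ => S) N) hT] at this
  exact this

/-- The trajectory up to time `a + 1`, assembled from the trajectory up to time `a` and the state
at time `a + 1`. -/
def extendHistory {S : Type*} (a : ℕ) (p : ((_ : Finset.Iic a) → S) × S) :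
    (_ : Finset.Iic (a + 1)) → S :=
  fun i => if h : i.1 ≤ a then p.1 ⟨i.1, Finset.mem_Iic.mpr h⟩ else p.2

theorem measurable_extendHistory {S : Type*} [MeasurableSpace S] (a : ℕ) :
    Measurable (extendHistory (S := S) a) := by
  refine measurable_pi_lambda _ fun i => ?_
  by_cases h : i.1 ≤ a
  · simp only [extendHistory, h, dite_true]
    fun_prop
  · simp only [extendHistory, h, dite_false]
    fun_prop

theorem extendHistory_frestrictLe {S : Type*} (a : ℕ) (x : ℕ → S) :
    extendHistory a (Preorder.frestrictLe (π := fun _ => S) a x, x (a + 1))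
      = Preorder.frestrictLe (π := fun _ => S) (a + 1) x := by
  funext i
  by_cases h : i.1 ≤ a
  · simp [extendHistory, h]
  · have : i.1 = a + 1 := by
      have := Finset.mem_Iic.mp i.2
      omega
    simp [extendHistory, this]

/-- The property that, under `m`, the next state is distributed according to `P` of the current
state, given the past. -/
def IsChainLaw {S : Type*} [MeasurableSpace S] (P : Kernel S S) (m : Measure (ℕ → S)) : Prop :=
  ∀ a, m.map (Preorder.frestrictLe (π := fun _ => S) a) ⊗ₘ stepKernel P a
    = m.map (fun x => (Preorder.frestrictLe (π := fun _ => S) a x, x (a + 1)))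

theorem isChainLaw_chainLaw {S : Type*} [MeasurableSpace S] (P : Kernel S S) [IsMarkovKernel P]
    (μ : Measure S) [IsProbabilityMeasure μ] : IsChainLaw P (chainLaw P μ) :=
  fun _ => Kernel.map_frestrictLe_trajMeasure_compProd_eq_map_trajMeasure (X := fun _ => S)

/-- Uniqueness of the law of a Markov chain with a given initial distribution. -/
theorem IsChainLaw.unique {S : Type*} [MeasurableSpace S] {P : Kernel S S}
    {m m' : Measure (ℕ → S)} [IsProbabilityMeasure m] [IsProbabilityMeasure m']
    (hm : IsChainLaw P m) (hm' : IsChainLaw P m')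
    (h0 : m.map (fun x => x 0) = m'.map (fun x => x 0)) : m = m' := by
  refine measure_ext_of_map_frestrictLe fun a => ?_
  induction a with
  | zero =>
    have key : ∀ ν : Measure (ℕ → S), ν.map (Preorder.frestrictLe (π := fun _ => S) 0)
        = (ν.map (fun x => x 0)).map (fun s (_ : Finset.Iic 0) => s) := by
      intro ν
      rw [Measure.map_map (by fun_prop) (by fun_prop)]
      congr 1
      funext x i
      have : i.1 = 0 := by simpa using Finset.mem_Iic.mp i.2
      simp [this]
    rw [key, key, h0]
  | succ a ih =>
    have key : ∀ ν : Measure (ℕ → S), ν.map (Preorder.frestrictLe (π := fun _ => S) (a + 1))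
        = (ν.map (fun x => (Preorder.frestrictLe (π := fun _ => S) a x, x (a + 1)))).map
          (extendHistory a) := by
      intro ν
      rw [Measure.map_map (measurable_extendHistory a) (by fun_prop)]
      congr 1
      funext x
      exact (extendHistory_frestrictLe a x).symm
    rw [key, key, ← hm a, ← hm' a, ih]

theorem map_prodMap_compProd_comap {X Y Z : Type*} [MeasurableSpace X] [MeasurableSpace Y]
    [MeasurableSpace Z] (μ : Measure X) [SFinite μ] (κ : Kernel Y Z) [IsSFiniteKernel κ]
    {f : X → Y} (hf : Measurable f) :
    (μ ⊗ₘ κ.comap f hf).map (Prod.map f id) = μ.map f ⊗ₘ κ := by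
  ext t ht
  rw [Measure.map_apply (by fun_prop) ht, Measure.compProd_apply (ht.preimage (by fun_prop)),
    Measure.compProd_apply ht, lintegral_map (Kernel.measurable_kernel_prodMk_left ht) hf]
  rfl

/-- Time-homogeneity enters here: the step kernel sees only the last state, so it factors through
`tail`, which forgets time 0. -/
theorem IsChainLaw.map_shift {S : Type*} [MeasurableSpace S] {P : Kernel S S} [IsMarkovKernel P]
    {m : Measure (ℕ → S)} [IsProbabilityMeasure m] (hm : IsChainLaw P m) :
    IsChainLaw P (m.map shift) := by
  intro a
  let tail : ((_ : Finset.Iic (a + 1)) → S) → ((_ : Finset.Iic a) → S) :=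
    fun x i => x ⟨i.1 + 1, Finset.mem_Iic.mpr (Nat.succ_le_succ (Finset.mem_Iic.mp i.2))⟩
  have ht : Measurable tail := by fun_prop
  have hstep : stepKernel P (a + 1) = (stepKernel P a).comap tail ht := by
    ext x : 1
    rfl
  have h1 : (m.map shift).map (Preorder.frestrictLe (π := fun _ => S) a)
      = (m.map (Preorder.frestrictLe (π := fun _ => S) (a + 1))).map tail := by
    rw [Measure.map_map (by fun_prop) measurable_shift, Measure.map_map ht (by fun_prop)]
    rfl
  rw [h1, ← map_prodMap_compProd_comap _ _ ht, ← hstep, hm (a + 1),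
    Measure.map_map (by fun_prop) (by fun_prop), Measure.map_map (by fun_prop) measurable_shift]
  rfl

theorem chainLaw_apply {S : Type*} [MeasurableSpace S] (P : Kernel S S) [IsMarkovKernel P]
    (μ : Measure S) {L : Set (ℕ → S)} (hL : MeasurableSet L) :
    chainLaw P μ L = ∫⁻ s, Kernel.traj (X := fun _ => S) (stepKernel P) 0 (fun _ => s) L ∂μ := by
  rw [chainLaw, Kernel.trajMeasure, Measure.bind_apply hL (by fun_prop), lintegral_map]
  · rfl
  · exact Kernel.measurable_coe _ hL
  · fun_prop

theorem chainLaw_dirac_apply {S : Type*} [MeasurableSpace S] (P : Kernel S S) [IsMarkovKernel P]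
    (s : S) {L : Set (ℕ → S)} (hL : MeasurableSet L) :
    chainLaw P (Measure.dirac s) L
      = Kernel.traj (X := fun _ => S) (stepKernel P) 0 (fun _ => s) L := by
  rw [chainLaw_apply P _ hL, lintegral_dirac']
  exact (Kernel.measurable_coe _ hL).comp (by fun_prop)

theorem measurable_chainLaw_dirac {S : Type*} [MeasurableSpace S] (P : Kernel S S)
    [IsMarkovKernel P] {L : Set (ℕ → S)} (hL : MeasurableSet L) :
    Measurable fun s => chainLaw P (Measure.dirac s) L := by
  simp_rw [chainLaw_dirac_apply P _ hL]
  exact (Kernel.measurable_coe _ hL).comp (by fun_prop)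

theorem map_eval_zero_chainLaw {S : Type*} [MeasurableSpace S] (P : Kernel S S) [IsMarkovKernel P]
    (μ : Measure S) : (chainLaw P μ).map (fun x => x 0) = μ := by
  have h : ∀ s : S, (Kernel.traj (X := fun _ => S) (stepKernel P) 0 (fun _ => s)).map
      (Preorder.frestrictLe 0) = Measure.dirac (fun _ => s) := by
    intro s
    rw [Kernel.traj_map_frestrictLe_apply, Kernel.partialTraj_self, Kernel.id_apply]
  ext t ht
  rw [Measure.map_apply (by fun_prop) ht, chainLaw_apply P μ (ht.preimage (by fun_prop)),
    ← lintegral_indicator_one ht]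
  congr 1 with s
  have ht' : MeasurableSet {x : (_ : Finset.Iic 0) → S | x ⟨0, by simp⟩ ∈ t} :=
    ht.preimage (by fun_prop)
  have := congrArg (fun μ => μ {x : (_ : Finset.Iic 0) → S | x ⟨0, by simp⟩ ∈ t}) (h s)
  simp only [Measure.map_apply (Preorder.measurable_frestrictLe (X := fun _ => S) 0) ht',
    Measure.dirac_apply' _ ht'] at this
  exact this

theorem ae_chainLaw_dirac_eval_zero {S : Type*} [MeasurableSpace S] (P : Kernel S S)
    [IsMarkovKernel P] (s : S) {t : Set S} (ht : MeasurableSet t) (hs : s ∈ t) :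
    ∀ᵐ x ∂chainLaw P (Measure.dirac s), x 0 ∈ t := by
  have h := map_eval_zero_chainLaw P (Measure.dirac s)
  have h2 : ∀ᵐ y ∂(Measure.dirac s), y ∈ t := by
    exact (ae_dirac_iff ht).mpr hs
  rw [← h] at h2
  exact ae_of_ae_map (measurable_pi_apply 0).aemeasurable h2

/-- The Markov property at time one. -/
theorem map_shift_chainLaw_dirac {S : Type*} [MeasurableSpace S] (P : Kernel S S)
    [IsMarkovKernel P] (s : S) :
    (chainLaw P (Measure.dirac s)).map shift = chainLaw P (P s) := by
  have := Measure.isProbabilityMeasure_map (μ := chainLaw P (Measure.dirac s))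
    (measurable_shift (S := S)).aemeasurable
  refine (isChainLaw_chainLaw P _).map_shift.unique (isChainLaw_chainLaw P _) ?_
  rw [map_eval_zero_chainLaw, Measure.map_map (by fun_prop) measurable_shift]
  -- The law of the state at time 1 is the second marginal of the case `a = 0`.
  have h := isChainLaw_chainLaw P (Measure.dirac s) 0
  have h0 : (chainLaw P (Measure.dirac s)).map (Preorder.frestrictLe (π := fun _ => S) 0)
      = Measure.dirac (fun _ => s) := by
    have e : Preorder.frestrictLe (π := fun _ => S) 0
        = (fun s (_ : Finset.Iic 0) => s) ∘ (fun x : ℕ → S => x 0) := by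
      funext x i
      have : i.1 = 0 := by simpa using Finset.mem_Iic.mp i.2
      simp [this]
    rw [e, ← Measure.map_map (by fun_prop) (by fun_prop), map_eval_zero_chainLaw,
      Measure.map_dirac' (by fun_prop)]
  have h2 := congrArg (fun μ => μ.map Prod.snd) h
  simp only [h0] at h2
  rw [Measure.map_map (by fun_prop) (by fun_prop)] at h2
  refine Eq.trans h2.symm ?_
  ext t ht
  rw [Measure.map_apply measurable_snd ht, Measure.compProd_apply (ht.preimage (by fun_prop)),
    lintegral_dirac']
  · rfl
  · exact Kernel.measurable_kernel_prodMk_left (ht.preimage (by fun_prop))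

/-- First-step analysis. -/
theorem chainLaw_dirac_preimage_shift {S : Type*} [MeasurableSpace S] (P : Kernel S S)
    [IsMarkovKernel P] (s : S) {L : Set (ℕ → S)} (hL : MeasurableSet L) :
    chainLaw P (Measure.dirac s) (shift ⁻¹' L)
      = ∫⁻ y, chainLaw P (Measure.dirac y) L ∂(P s) := by
  rw [← Measure.map_apply measurable_shift hL, map_shift_chainLaw_dirac, chainLaw_apply P _ hL]
  simp_rw [chainLaw_dirac_apply P _ hL]

/-! ### Measurability of the events -/

theorem measurableSet_stayIn {S : Type*} [MeasurableSpace S] {I : Set S} (hI : MeasurableSet I) :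
    MeasurableSet (stayIn I) := by
  have : stayIn I = ⋂ n, (fun ω : ℕ → S => ω n) ⁻¹' I := by
    ext ω
    simp [stayIn]
  rw [this]
  exact MeasurableSet.iInter fun n => hI.preimage (measurable_pi_apply n)

theorem measurableSet_reactivity {S : Type*} [MeasurableSpace S] {k : ℕ} {A B : Fin k → Set S}
    (hA : ∀ i, MeasurableSet (A i)) (hB : ∀ i, MeasurableSet (B i)) :
    MeasurableSet (reactivity A B) := by
  refine MeasurableSet.iInter fun i => MeasurableSet.union ?_ ?_
  · exact MeasurableSet.iUnion fun n => MeasurableSet.iInter fun m => MeasurableSet.iInter fun _ =>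
      (hA i).compl.preimage (measurable_pi_apply m)
  · exact MeasurableSet.iInter fun n => MeasurableSet.iUnion fun m => MeasurableSet.iUnion fun _ =>
      (hB i).preimage (measurable_pi_apply m)

theorem returnTime_lt_top_iff {S : Type*} (C : Set S) (ω : ℕ → S) :
    returnTime C ω < ⊤ ↔ ∃ n, ω (n + 1) ∈ C := by
  have h : hitTime C (shift ω) = ⊤ ↔ ∀ j, 0 ≤ j → shift ω j ∉ C := hittingAfter_eq_top_iff
  have h2 : returnTime C ω < ⊤ ↔ hitTime C (shift ω) ≠ ⊤ := by
    rw [returnTime, lt_top_iff_ne_top]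
    simp
  rw [h2, ne_eq, h]
  simp [shift]

theorem measurableSet_returnTime_lt_top {S : Type*} [MeasurableSpace S] {C : Set S}
    (hC : MeasurableSet C) : MeasurableSet {ω : ℕ → S | returnTime C ω < ⊤} := by
  simp_rw [returnTime_lt_top_iff, Set.ofPred_exists]
  exact MeasurableSet.iUnion fun n => hC.preimage (measurable_pi_apply (n + 1))

/-! ### Staying in a set forever -/

/-- If the probability of staying in `G` forever is bounded by some `c < 1` from every state of
`G`, then it is zero. -/
theorem chainLaw_dirac_stayIn_eq_zero {S : Type*} [MeasurableSpace S] (P : Kernel S S)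
    [IsMarkovKernel P] {G : Set S} (hG : MeasurableSet G) {c : ℝ≥0∞} (hc : c < 1)
    (h : ∀ x ∈ G, chainLaw P (Measure.dirac x) (stayIn G) ≤ c) (x : S) :
    chainLaw P (Measure.dirac x) (stayIn G) = 0 := by
  have hout : ∀ x ∉ G, chainLaw P (Measure.dirac x) (stayIn G) = 0 := by
    intro x hx
    refine measure_mono_null (t := {ω | ¬ ω 0 ∈ Gᶜ}) (fun ω hω => not_not.mpr (hω 0)) ?_
    exact ae_chainLaw_dirac_eval_zero P x hG.compl hx
  let T : ℕ → Set (ℕ → S) := fun n => {ω | ∀ j < n, ω j ∈ G}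
  have hT : ∀ n, MeasurableSet (T n) := by
    intro n
    have : T n = ⋂ j, ⋂ (_ : j < n), (fun ω : ℕ → S => ω j) ⁻¹' G := by
      ext ω
      simp [T]
    rw [this]
    exact MeasurableSet.iInter fun j => MeasurableSet.iInter fun _ =>
      hG.preimage (measurable_pi_apply j)
  -- Staying forever means staying for `n` steps and then forever, which costs a factor `c`. Letting
  -- `n → ∞` gives `p ≤ c * p` for the finite number `p` in question, so `p = 0`.
  have hbound : ∀ n x, chainLaw P (Measure.dirac x) (stayIn G)
      ≤ c * chainLaw P (Measure.dirac x) (T n) := by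
    intro n
    induction n with
    | zero =>
      intro x
      have : T 0 = Set.univ := by
        ext ω
        simp [T]
      rw [this, measure_univ, mul_one]
      by_cases hx : x ∈ G
      · exact h x hx
      · simp [hout x hx]
    | succ n ih =>
      intro x
      by_cases hx : x ∈ G
      · calc chainLaw P (Measure.dirac x) (stayIn G)
            ≤ chainLaw P (Measure.dirac x) (shift ⁻¹' stayIn G) :=
              measure_mono fun ω hω n => hω (n + 1)
          _ = ∫⁻ y, chainLaw P (Measure.dirac y) (stayIn G) ∂(P x) :=
              chainLaw_dirac_preimage_shift P x (measurableSet_stayIn hG)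
          _ ≤ ∫⁻ y, c * chainLaw P (Measure.dirac y) (T n) ∂(P x) := lintegral_mono ih
          _ = c * chainLaw P (Measure.dirac x) (shift ⁻¹' T n) := by
              rw [lintegral_const_mul _ (measurable_chainLaw_dirac P (hT n)),
                chainLaw_dirac_preimage_shift P x (hT n)]
          _ ≤ c * chainLaw P (Measure.dirac x) (T (n + 1)) := by
              gcongr 1
              refine measure_mono_ae ?_
              filter_upwards [ae_chainLaw_dirac_eval_zero P x hG hx] with ω h0 hω j hj
              cases j with
              | zero => exact h0
              | succ j => exact hω j (by omega)
      · simp [hout x hx]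
  have hlim : Tendsto (fun n => chainLaw P (Measure.dirac x) (T n)) atTop
      (𝓝 (chainLaw P (Measure.dirac x) (stayIn G))) := by
    have hs : stayIn G = ⋂ n, T n := by
      ext ω
      simp only [stayIn, T, Set.mem_iInter, Set.mem_ofPred_eq]
      exact ⟨fun hω _ j _ => hω j, fun hω n => hω (n + 1) n (by omega)⟩
    rw [hs]
    refine tendsto_measure_iInter_atTop (fun n => (hT n).nullMeasurableSet) ?_
      ⟨0, measure_ne_top _ _⟩
    exact fun m n hmn ω hω j hj => hω j (hj.trans_le hmn)
  have hle := ge_of_tendsto' (ENNReal.Tendsto.const_mul hlim (Or.inr hc.ne_top))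
    (fun n => hbound n x)
  by_contra hne
  have := ENNReal.mul_lt_mul_left hne (measure_ne_top _ _) hc
  rw [one_mul] at this
  exact absurd hle (not_le.mpr this)

/-- If staying in `G` forever has probability zero from every state, then so does being eventually
always in `G`. -/
theorem ae_chainLaw_dirac_not_eventually_mem {S : Type*} [MeasurableSpace S] (P : Kernel S S)
    [IsMarkovKernel P] {G : Set S} (hG : MeasurableSet G)
    (h : ∀ x, chainLaw P (Measure.dirac x) (stayIn G) = 0) (s : S) :
    ∀ᵐ ω ∂chainLaw P (Measure.dirac s), ∀ N, ∃ n ≥ N, ω n ∉ G := by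
  -- Measurability is carried along because first-step analysis requires it.
  have key : ∀ N x, MeasurableSet {ω : ℕ → S | ∀ n, ω (n + N) ∈ G} ∧
      chainLaw P (Measure.dirac x) {ω | ∀ n, ω (n + N) ∈ G} = 0 := by
    intro N
    induction N with
    | zero => exact fun x => ⟨measurableSet_stayIn hG, h x⟩
    | succ N ih =>
      intro x
      have e : {ω : ℕ → S | ∀ n, ω (n + (N + 1)) ∈ G}
          = shift ⁻¹' {ω : ℕ → S | ∀ n, ω (n + N) ∈ G} := rfl
      rw [e, chainLaw_dirac_preimage_shift P x (ih x).1]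
      exact ⟨(ih x).1.preimage measurable_shift, by simp [(ih _).2]⟩
  rw [ae_all_iff]
  intro N
  have hN : ∀ᵐ ω ∂chainLaw P (Measure.dirac s), ¬ ∀ n, ω (n + N) ∈ G :=
    measure_eq_zero_iff_ae_notMem.mp (key N s).2
  filter_upwards [hN] with ω hω
  obtain ⟨n, hn⟩ := not_forall.mp hω
  exact ⟨n + N, by omega, hn⟩

/-! ### Return probabilities and the theorem -/

theorem probFrom_eq_one_iff {S : Type*} [MeasurableSpace S] (P : Kernel S S) [IsMarkovKernel P]
    (s : S) {L : Set (ℕ → S)} (hL : MeasurableSet L) :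
    probFrom P s L = 1 ↔ ∀ᵐ ω ∂chainLaw P (Measure.dirac s), ω ∈ L := by
  have h1 : probFrom P s L = 1 ↔ chainLaw P (Measure.dirac s) L = 1 := by
    rw [← Subtype.coe_inj]
    exact ENNReal.toReal_eq_one_iff _
  rw [h1, ← prob_compl_eq_zero_iff hL]
  rfl

/-- Almost surely, a trajectory cannot eventually remain outside `A` while always having a
probability greater than `1 / 2` of returning to `A`. -/
theorem ae_frequently_not_mem_of_half_lt {S : Type*} [MeasurableSpace S] (P : Kernel S S)
    [IsMarkovKernel P] {A : Set S} (hA : MeasurableSet A) (s : S) :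
    ∀ᵐ ω ∂chainLaw P (Measure.dirac s), ∀ N, ∃ n ≥ N,
      ω n ∈ A ∨ (probFrom P (ω n) {ω | returnTime A ω < ⊤} : ℝ) ≤ 1 / 2 := by
  have hR := measurableSet_returnTime_lt_top hA
  let G : Set S := Aᶜ ∩ {x | (1 / 2 : ℝ) < probFrom P x {ω | returnTime A ω < ⊤}}
  have hG : MeasurableSet G :=
    hA.compl.inter (measurableSet_lt measurable_const
      (measurable_chainLaw_dirac P hR).ennreal_toReal)
  have hstay : ∀ x ∈ G, chainLaw P (Measure.dirac x) (stayIn G) ≤ ENNReal.ofReal (1 / 2) := by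
    intro x hx
    refine (measure_mono (t := {ω | returnTime A ω < ⊤}ᶜ) ?_).trans ?_
    · intro ω hω hret
      obtain ⟨n, hn⟩ := (returnTime_lt_top_iff A ω).mp hret
      exact (hω (n + 1)).1 hn
    · rw [← ofReal_measureReal, probReal_compl_eq_one_sub hR]
      have h2 : (1 / 2 : ℝ) < (chainLaw P (Measure.dirac x)).real {ω | returnTime A ω < ⊤} := hx.2
      exact ENNReal.ofReal_le_ofReal (by linarith)
  have hc : ENNReal.ofReal (1 / 2) < 1 := by
    rw [ENNReal.ofReal_lt_one]
    norm_num
  filter_upwards [ae_chainLaw_dirac_not_eventually_mem P hG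
    (chainLaw_dirac_stayIn_eq_zero P hG hc hstay) s] with ω hω N
  obtain ⟨n, hn, hnG⟩ := hω N
  refine ⟨n, hn, ?_⟩
  by_contra hcon
  push Not at hcon
  exact hnG hcon

theorem mainTheorem4 {S : Type*} [MeasurableSpace S] (P : Kernel S S) [IsMarkovKernel P]
    {k : ℕ} (A B : Fin k → Set S)
    (hA : ∀ i, MeasurableSet (A i)) (hB : ∀ i, MeasurableSet (B i))
    (I : Set S) (hI : MeasurableSet I)
    (hreact : ∀ s : S, probFrom P s ((stayIn I)ᶜ ∪ reactivity A B) = 1) :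
    ∃ J : Fin k → Set S,
      (∀ i, J i = {s ∈ I \ A i | (probFrom P s {ω | returnTime (A i) ω < ⊤} : ℝ) ≤ 1 / 2}) ∧
      ∀ i, MeasurableSet (J i) ∧ J i ⊆ I \ A i ∧
        (⨆ s ∈ J i, probFrom P s {ω | returnTime (A i) ω < ⊤}) < 1 ∧
        (⨅ s ∈ I, probFrom P s {ω | returnTime (B i ∪ J i ∪ Iᶜ) ω < ⊤}) = 1 := by
  refine ⟨_, fun i => rfl, fun i => ?_⟩
  have hR := measurableSet_returnTime_lt_top (hA i)
  set J : Set S := {s ∈ I \ A i | (probFrom P s {ω | returnTime (A i) ω < ⊤} : ℝ) ≤ 1 / 2}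
  have hJ : MeasurableSet J :=
    (hI.diff (hA i)).inter
      (measurableSet_le (measurable_chainLaw_dirac P hR).ennreal_toReal measurable_const)
  refine ⟨hJ, fun s hs => hs.1, ?_, ?_⟩
  · refine lt_of_le_of_lt (b := (⟨1 / 2, by norm_num, by norm_num⟩ : unitInterval))
      (iSup₂_le fun s hs => Subtype.coe_le_coe.mp hs.2) ?_
    rw [← Subtype.coe_lt_coe]
    norm_num
  · refine le_antisymm unitInterval.le_one' (le_iInf₂ fun s hs => ge_of_eq ?_)
    rw [probFrom_eq_one_iff P s (measurableSet_returnTime_lt_top ((hB i).union hJ |>.union hI.compl))]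
    have hr := (probFrom_eq_one_iff P s
      ((measurableSet_stayIn hI).compl.union (measurableSet_reactivity hA hB))).mp (hreact s)
    filter_upwards [hr, ae_chainLaw_dirac_eval_zero P s hI hs,
      ae_frequently_not_mem_of_half_lt P (hA i) s] with ω hω h0 hfreq
    rw [returnTime_lt_top_iff]
    by_contra! hno
    simp only [Set.mem_union, Set.mem_compl_iff, not_or, not_not] at hno
    have hstay : ω ∈ stayIn I := by
      intro n
      cases n with
      | zero => exact h0
      | succ n => exact (hno n).2
    have hω' := Set.mem_iInter.mp (hω.resolve_left fun h => h hstay) i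
    rcases hω' with hfin | hinf
    · obtain ⟨N, hN⟩ := Set.mem_iUnion.mp hfin
      simp only [Set.mem_iInter, Set.mem_ofPred_eq] at hN
      -- `N + 1` rather than `N` makes `n` positive: `hno` says nothing about time 0, when the
      -- trajectory may be in `J` or `B i`.
      obtain ⟨n, hn, hn'⟩ := hfreq (N + 1)
      have hnA := hN n (by omega)
      obtain ⟨m, rfl⟩ : ∃ m, n = m + 1 := ⟨n - 1, by omega⟩
      exact (hno m).1.2 ⟨⟨(hno m).2, hnA⟩, hn'.resolve_left hnA⟩
    · have h1 := Set.mem_iInter.mp hinf 1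
      simp only [Set.mem_iUnion, Set.mem_ofPred_eq] at h1
      obtain ⟨n, hn, hnB⟩ := h1
      obtain ⟨m, rfl⟩ : ∃ m, n = m + 1 := ⟨n - 1, by omega⟩
      exact (hno m).1.1 hnB
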